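/- For integers $n \ge k \ge 4$, let $G_n^k$ be the graph whose vertices are the ordered $k$-tuples of distinct elements of $[n]=\{1,\dots,n\}$, two tuples $(a_1,\dots,a_k)$ and $(b_1,\dots,b_k)$ being adjacent if and only if $a_i \ne b_i$ for every $i=1,\dots,k$. Then $G_n^k$ is edge pancyclic, that is, every edge of $G_n^k$ lies on a cycle of length $\ell$ for each integer $\ell$ with $3 \le \ell \le |V(G_n^k)| = n!/(n-k)!$. -/

import Mathlib

/-- A finite simple graph is edge pancyclic if its order is at least `3` and every edge lies on a
cycle of each length from `3` to the order of the graph. -/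
def SimpleGraph.IsEdgePancyclic {V : Type*} [Fintype V] (G : SimpleGraph V) : Prop :=
  3 ≤ Fintype.card V ∧
    ∀ e ∈ G.edgeSet, ∀ l : ℕ, 3 ≤ l → l ≤ Fintype.card V →
      ∃ (v : V) (c : G.Walk v v), c.IsCycle ∧ c.length = l ∧ e ∈ c.edges

/-- The graph whose vertices are the ordered `k`-tuples of distinct elements of an `n`-element
set (injections `Fin k ↪ Fin n`), two of them being adjacent iff they differ in every coordinate.
The clause `a ≠ b` only matters for `k = 0`, where it excludes a loop at the empty tuple. -/
def arrangementDiffGraph (n k : ℕ) : SimpleGraph (Fin k ↪ Fin n) where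
  Adj a b := a ≠ b ∧ ∀ i, a i ≠ b i
  symm := ⟨fun _ _ h => ⟨h.1.symm, fun i => (h.2 i).symm⟩⟩
  loopless := ⟨fun _ h => h.1 rfl⟩

theorem arrangementDiffGraph_adj {n k : ℕ} (hk : 0 < k) (a b : Fin k ↪ Fin n) :
    (arrangementDiffGraph n k).Adj a b ↔ ∀ i, a i ≠ b i :=
  ⟨fun h => h.2, fun h => ⟨fun hab => h ⟨0, hk⟩ (by rw [hab]), h⟩⟩

/-! An edge `u v` lies on a cycle of length `l` as soon as `u` and `v` are joined by a path on `l ≥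
3` vertices. Adding a constant modulo `n` to all entries splits the tuples into classes that are
cliques of size `n`. Exchanges in one fixed position make the classes a connected system in which
each has fewer than `n` neighbors; any two tuples of a class are joined by disjoint edges to any
neighboring class.

A path grows from the classes of `u` and `v`: one of its edges inside a visited class is replaced by
a detour through 2 to `n` vertices of a new neighboring class (`exists_insert`). A class traversed
completely in one run has `n - 1` path edges, one for each possible neighbor, and a detour costs one
edge while using up one outside neighbor, so growth never stalls. Detours cannot add a single
vertex, so a companion path with one vertex less is carried along (`exists_isPathList_of_lt`).

For `u`, `v` in different classes this starts at 4 vertices; 3 vertices need a common neighbor,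
given by Hall's theorem (`exists_adj_adj`). -/

open Finset

/-! ### Paths as vertex lists -/

namespace SimpleGraph

/-- The list `L` is the vertex sequence of a path of `G` from `u` to `v`. -/
structure IsPathList {V : Type*} (G : SimpleGraph V) (u v : V) (L : List V) : Prop where
  chain : L.IsChain G.Adj
  nodup : L.Nodup
  head : L.head? = some u
  last : L.getLast? = some v

namespace IsPathList

variable {V : Type*} {G : SimpleGraph V} {u v x y x' y' : V} {L M l₁ l₂ : List V}

theorem exists_walk (hL : G.IsPathList u v L) :
    ∃ p : G.Walk u v, p.IsPath ∧ p.length + 1 = L.length := by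
  have hne : L ≠ [] := by rintro rfl; simpa using hL.head
  have hu : L.head hne = u := by
    have := hL.head; rw [List.head?_eq_some_head hne] at this; simpa using this
  have hv : L.getLast hne = v := by
    have := hL.last; rw [List.getLast?_eq_some_getLast hne] at this; simpa using this
  subst hu hv
  refine ⟨Walk.ofSupport L hne hL.chain, Walk.IsPath.mk' ?_, ?_⟩
  · rw [Walk.support_ofSupport]; exact hL.nodup
  · rw [Walk.length_ofSupport]
    have := List.length_pos_iff.2 hne
    omega

/-- A path on at least three vertices joining the ends of an edge closes up to a cycle. -/
theorem exists_isCycle (hL : G.IsPathList u v L) (huv : G.Adj u v) (h3 : 3 ≤ L.length) :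
    ∃ (w : V) (c : G.Walk w w), c.IsCycle ∧ c.length = L.length ∧ s(u, v) ∈ c.edges := by
  obtain ⟨p, hp, hlen⟩ := hL.exists_walk
  refine ⟨v, Walk.cons huv.symm p, ?_, by simpa using hlen, by simp [Sym2.eq_swap]⟩
  rw [Walk.cons_isCycle_iff]
  refine ⟨hp, fun hmem => ?_⟩
  cases p with
  | nil => simp at hlen; omega
  | @cons _ w _ h q =>
    rw [Walk.cons_isPath_iff] at hp
    rw [Walk.edges_cons, List.mem_cons] at hmem
    rcases hmem with hmem | hmem
    · rw [Sym2.eq_swap, Sym2.congr_right] at hmem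
      subst hmem
      have := Walk.length_eq_zero_iff.2 (Walk.isPath_iff_nil.1 hp.1)
      simp at hlen; omega
    · exact hp.2 (Walk.snd_mem_support_of_mem_edges q hmem)

/-- Concatenation of two disjoint paths along an edge. -/
theorem append (hL : G.IsPathList u x L) (hM : G.IsPathList y v M) (hxy : G.Adj x y)
    (hd : L.Disjoint M) : G.IsPathList u v (L ++ M) where
  chain := by
    refine List.isChain_append.2 ⟨hL.chain, hM.chain, ?_⟩
    rw [hL.last, hM.head]
    simpa using hxy
  nodup := List.nodup_append'.2 ⟨hL.nodup, hM.nodup, hd⟩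
  head := by rw [List.head?_append, hL.head]; rfl
  last := by rw [List.getLast?_append, hM.last]; rfl

theorem left_of_append (hL : G.IsPathList u v (l₁ ++ x :: y :: l₂)) :
    G.IsPathList u x (l₁ ++ [x]) where
  chain := by have := hL.chain; rw [List.isChain_append_cons_cons] at this; exact this.1
  nodup := hL.nodup.sublist (by simp)
  head := by have := hL.head; cases l₁ <;> simpa using this
  last := by simp

theorem right_of_append (hL : G.IsPathList u v (l₁ ++ x :: y :: l₂)) :
    G.IsPathList y v (y :: l₂) where
  chain := by have := hL.chain; rw [List.isChain_append_cons_cons] at this; exact this.2.2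
  nodup := hL.nodup.sublist ((List.sublist_cons_self _ _).trans (List.sublist_append_right _ _))
  head := rfl
  last := by simpa using hL.last

/-- A path stays a path when one of its edges `x y` is replaced by a detour `x, M, y` through
new vertices. -/
theorem insert (hL : G.IsPathList u v (l₁ ++ x :: y :: l₂)) (hM : G.IsPathList x' y' M)
    (hx : G.Adj x x') (hy : G.Adj y y') (hd : (l₁ ++ x :: y :: l₂).Disjoint M) :
    G.IsPathList u v (l₁ ++ [x] ++ (M ++ y :: l₂)) := by
  refine hL.left_of_append.append (hM.append hL.right_of_append hy.symm ?_) hx ?_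
  · intro z hz hz'
    exact hd (by simp at hz' ⊢; tauto) hz
  · have := hL.nodup
    rw [show l₁ ++ x :: y :: l₂ = (l₁ ++ [x]) ++ y :: l₂ by simp, List.nodup_append'] at this
    intro z hz hz'
    rcases List.mem_append.1 hz' with h | h
    · exact hd (by simp at hz ⊢; tauto) h
    · exact this.2.2 hz h

end IsPathList

end SimpleGraph

/-! ### Counting path edges inside a fiber -/

/-- The number of pairs of consecutive entries of a list that both lie over `q`. -/
def List.fiberEdges {V Q : Type*} [DecidableEq Q] (π : V → Q) (q : Q) : List V → ℕ
  | [] => 0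
  | [_] => 0
  | x :: y :: l => (if π x = q ∧ π y = q then 1 else 0) + List.fiberEdges π q (y :: l)

namespace List

variable {V Q : Type*} [DecidableEq Q] {π : V → Q} {q : Q}

theorem fiberEdges_append_cons (x : V) (l₂ : List V) : ∀ l₁ : List V,
    (l₁ ++ x :: l₂).fiberEdges π q = (l₁ ++ [x]).fiberEdges π q + (x :: l₂).fiberEdges π q
  | [] => by simp [fiberEdges]
  | [z] => by simp [fiberEdges]
  | z :: w :: l => by
    have := fiberEdges_append_cons x l₂ (w :: l)
    simp only [cons_append, fiberEdges] at this ⊢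
    omega

theorem fiberEdges_append_cons_cons (x y : V) (l₁ l₂ : List V) :
    (l₁ ++ x :: y :: l₂).fiberEdges π q = (l₁ ++ [x]).fiberEdges π q +
      (if π x = q ∧ π y = q then 1 else 0) + (y :: l₂).fiberEdges π q := by
  rw [fiberEdges_append_cons, fiberEdges, add_assoc]

theorem fiberEdges_add_le_append : ∀ l₁ l₂ : List V,
    l₁.fiberEdges π q + l₂.fiberEdges π q ≤ (l₁ ++ l₂).fiberEdges π q
  | [], l₂ => by simp [fiberEdges]
  | [x], [] => by simp [fiberEdges]
  | [x], y :: l => by simp [fiberEdges]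
  | x :: y :: l, l₂ => by
    have := fiberEdges_add_le_append (y :: l) l₂
    simp only [cons_append, fiberEdges] at this ⊢
    omega

theorem fiberEdges_of_forall : ∀ l : List V, (∀ x ∈ l, π x = q) →
    l.fiberEdges π q = l.length - 1
  | [], _ => rfl
  | [_], _ => rfl
  | x :: y :: l, h => by
    have := fiberEdges_of_forall (y :: l) fun z hz => h z (mem_cons_of_mem _ hz)
    rw [fiberEdges, this, if_pos ⟨h x (by simp), h y (by simp)⟩]
    simp; omega

theorem exists_of_fiberEdges_pos : ∀ l : List V, 0 < l.fiberEdges π q →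
    ∃ l₁ x y l₂, l = l₁ ++ x :: y :: l₂ ∧ π x = q ∧ π y = q
  | [], h => by simp [fiberEdges] at h
  | [_], h => by simp [fiberEdges] at h
  | x :: y :: l, h => by
    by_cases hxy : π x = q ∧ π y = q
    · exact ⟨[], x, y, l, rfl, hxy⟩
    · rw [fiberEdges, if_neg hxy, zero_add] at h
      obtain ⟨l₁, x', y', l₂, h₁, h₂⟩ := exists_of_fiberEdges_pos (y :: l) h
      exact ⟨x :: l₁, x', y', l₂, by simp [h₁], h₂⟩

end List

/-! ### Growing paths in clique fibrations -/

namespace SimpleGraph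

/-- The vertices of `G` are partitioned by `π` into cliques with `n` elements; the fibers over
`N`-related points are joined by enough disjoint edges, and `N` is a symmetric connected relation
of degree less than `n`. -/
structure IsCliqueFibration {V Q : Type*} [Fintype V] [Fintype Q] [DecidableEq Q]
    (G : SimpleGraph V) (π : V → Q) (N : Q → Q → Prop) [DecidableRel N] (n : ℕ) : Prop where
  adj_of_ne : ∀ x y, π x = π y → x ≠ y → G.Adj x y
  card_fiber : ∀ q, #{x | π x = q} = n
  symm : ∀ A B, N A B → N B A
  degree_lt : ∀ A, #{B | N A B} < n
  exists_boundary : ∀ S : Finset Q, S.Nonempty → S ≠ univ → ∃ A ∈ S, ∃ B ∉ S, N A B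
  exists_adj : ∀ A B, N A B → ∀ x y, x ≠ y → π x = A → π y = A →
    ∃ x' y', x' ≠ y' ∧ π x' = B ∧ π y' = B ∧ G.Adj x x' ∧ G.Adj y y'

namespace IsCliqueFibration

/-- Every fiber over `A ∈ S` contains at least as many edges of the path `L` as `A` has neighbors
outside `S`. -/
def Ample {V Q : Type*} [Fintype Q] [DecidableEq Q] (π : V → Q) (N : Q → Q → Prop)
    [DecidableRel N] (S : Finset Q) (L : List V) : Prop :=
  ∀ A ∈ S, #{B | B ∉ S ∧ N A B} ≤ L.fiberEdges π A

/-- Every fiber over an `A ∈ S` with a neighbor outside `S` contains an edge of the path `L`. -/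
def Extendable {V Q : Type*} [DecidableEq Q] (π : V → Q) (N : Q → Q → Prop) (S : Finset Q)
    (L : List V) : Prop :=
  ∀ A ∈ S, (∃ B ∉ S, N A B) → 0 < L.fiberEdges π A

theorem Ample.extendable {V Q : Type*} [Fintype Q] [DecidableEq Q] {π : V → Q}
    {N : Q → Q → Prop} [DecidableRel N] {S : Finset Q} {L : List V} (h : Ample π N S L) :
    Extendable π N S L := by
  rintro A hA ⟨B, hB, hAB⟩
  refine lt_of_lt_of_le (card_pos.2 ⟨B, ?_⟩) (h A hA)
  simp [hB, hAB]

variable {V Q : Type*} [Fintype V] [Fintype Q] [DecidableEq Q]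
  {G : SimpleGraph V} {π : V → Q} {N : Q → Q → Prop} [DecidableRel N] {n : ℕ} {u v : V}

theorem exists_isPathList_fiber (hG : G.IsCliqueFibration π N n) {x y : V} (hne : x ≠ y)
    (hxy : π x = π y) {j : ℕ} (h2 : 2 ≤ j) (hj : j ≤ n) :
    ∃ M, G.IsPathList x y M ∧ (∀ z ∈ M, π z = π x) ∧ M.length = j := by
  classical
  have hcard : j - 2 ≤ #((({z | π z = π x} : Finset V).erase x).erase y) := by
    rw [card_erase_of_mem (by simp [hxy, hne.symm]), card_erase_of_mem (by simp), hG.card_fiber]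
    omega
  obtain ⟨T, hT, hTc⟩ := exists_subset_card_eq hcard
  have hT' : ∀ z ∈ T, z ≠ y ∧ z ≠ x ∧ π z = π x := fun z hz => by simpa using hT hz
  have hnd : (x :: (T.toList ++ [y])).Nodup := by
    rw [List.nodup_cons, List.nodup_append']
    refine ⟨?_, T.nodup_toList, List.nodup_singleton _, ?_⟩
    · simp only [List.mem_append, mem_toList, List.mem_singleton, not_or]
      exact ⟨fun h => (hT' x h).2.1 rfl, hne⟩
    · intro z hz hz'
      exact (hT' z (by simpa using hz)).1 (by simpa using hz')
  have hπ : ∀ z ∈ x :: (T.toList ++ [y]), π z = π x := by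
    intro z hz
    simp only [List.mem_cons, List.mem_append, mem_toList, List.not_mem_nil, or_false] at hz
    rcases hz with rfl | hz | rfl
    · rfl
    · exact (hT' z hz).2.2
    · exact hxy.symm
  refine ⟨x :: (T.toList ++ [y]), ⟨?_, hnd, rfl, ?_⟩, hπ, ?_⟩
  · refine List.Pairwise.isChain (List.Pairwise.imp_of_mem ?_ hnd)
    intro a b ha hb hab
    exact hG.adj_of_ne a b ((hπ a ha).trans (hπ b hb).symm) hab
  · rw [← List.cons_append, List.getLast?_append]; rfl
  · simp [hTc]; omega

/-- A path over `S` can be extended by any number from `2` to `n` of vertices of a new fiber. -/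
theorem exists_insert (hG : G.IsCliqueFibration π N n) {S : Finset Q} {L : List V}
    (hL : G.IsPathList u v L) (hLS : ∀ z ∈ L, π z ∈ S) (hE : Extendable π N S L)
    (hS : S.Nonempty) (hS' : S ≠ univ) :
    ∃ D ∉ S, ∀ j, 2 ≤ j → j ≤ n → ∃ L', G.IsPathList u v L' ∧ (∀ z ∈ L', π z ∈ insert D S) ∧
      L'.length = L.length + j ∧
      (Ample π N S L → Extendable π N (insert D S) L' ∧ (j = n → Ample π N (insert D S) L')) := by
  obtain ⟨A, hA, D, hD, hAD⟩ := hG.exists_boundary S hS hS'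
  refine ⟨D, hD, fun j h2 hj => ?_⟩
  obtain ⟨l₁, x, y, l₂, rfl, hx, hy⟩ := List.exists_of_fiberEdges_pos L (hE A hA ⟨D, hD, hAD⟩)
  have hxy : x ≠ y := by
    have := (List.isChain_append_cons_cons.1 hL.chain).2.1
    exact this.ne
  obtain ⟨x', y', hne, hx', hy', hxx, hyy⟩ := hG.exists_adj A D hAD x y hxy hx hy
  obtain ⟨M, hM, hMD, hMl⟩ := hG.exists_isPathList_fiber hne (hx'.trans hy'.symm) h2 hj
  rw [hx'] at hMD
  have hL' := hL.insert hM hxx hyy fun z hz hz' => hD (hMD z hz' ▸ hLS z hz)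
  have hfD : j - 1 ≤ (l₁ ++ [x] ++ (M ++ y :: l₂)).fiberEdges π D := by
    have h₁ := List.fiberEdges_add_le_append (π := π) (q := D) (l₁ ++ [x]) (M ++ y :: l₂)
    have h₂ := List.fiberEdges_add_le_append (π := π) (q := D) M (y :: l₂)
    rw [List.fiberEdges_of_forall M hMD, hMl] at h₂
    omega
  -- The only edge lost is `x y`, which lies in the fiber over `A`.
  have hf : ∀ B, (l₁ ++ x :: y :: l₂).fiberEdges π B ≤
      (l₁ ++ [x] ++ (M ++ y :: l₂)).fiberEdges π B + if A = B then 1 else 0 := by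
    intro B
    have h₁ := List.fiberEdges_add_le_append (π := π) (q := B) (l₁ ++ [x]) (M ++ y :: l₂)
    have h₂ := List.fiberEdges_add_le_append (π := π) (q := B) M (y :: l₂)
    have h₃ := List.fiberEdges_append_cons_cons (π := π) (q := B) x y l₁ l₂
    simp only [hx, hy, and_self] at h₃
    omega
  have hold : Ample π N S (l₁ ++ x :: y :: l₂) → ∀ B ∈ S,
      #{C | C ∉ insert D S ∧ N B C} ≤ (l₁ ++ [x] ++ (M ++ y :: l₂)).fiberEdges π B := by
    intro hAm B hB
    have h₁ := hAm B hB
    have h₂ := hf B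
    split_ifs at h₂ with hAB
    · subst hAB
      have : #{C | C ∉ insert D S ∧ N A C} < #{C | C ∉ S ∧ N A C} := by
        refine card_lt_card (Finset.ssubset_iff_of_subset ?_ |>.2 ⟨D, ?_, ?_⟩)
        · intro C; simp; tauto
        · simp [hD, hAD]
        · simp
      omega
    · have : #{C | C ∉ insert D S ∧ N B C} ≤ #{C | C ∉ S ∧ N B C} := by
        refine card_le_card ?_
        intro C; simp; tauto
      omega
  refine ⟨_, hL', ?_, ?_, fun hAm => ⟨?_, fun hjn => ?_⟩⟩
  · intro z hz
    rcases List.mem_append.1 hz with hz | hz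
    · exact mem_insert_of_mem (hLS z (by simp at hz ⊢; tauto))
    · rcases List.mem_append.1 hz with hz | hz
      · rw [hMD z hz]; exact mem_insert_self _ _
      · exact mem_insert_of_mem (hLS z (by simp at hz ⊢; tauto))
  · simp [hMl]; omega
  · rintro B hB ⟨C, hC, hBC⟩
    rcases mem_insert.1 hB with rfl | hB
    · omega
    · exact lt_of_lt_of_le (card_pos.2 ⟨C, by simpa [hBC] using hC⟩) (hold hAm B hB)
  · intro B hB
    rcases mem_insert.1 hB with rfl | hB
    · refine le_trans ?_ hfD
      -- The neighbor `A` of the new point is already in `S`, so the inequality is strict.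
      have : #{C | C ∉ insert B S ∧ N B C} < #{C | N B C} := by
        refine card_lt_card (Finset.ssubset_iff_of_subset ?_ |>.2 ⟨A, ?_, ?_⟩)
        · intro C; simp
        · simpa using hG.symm _ _ hAD
        · simp [hA]
      have := hG.degree_lt B
      omega
    · exact hold hAm B hB

theorem card_eq (hG : G.IsCliqueFibration π N n) : Fintype.card V = Fintype.card Q * n := by
  rw [← card_univ, ← card_univ, card_eq_sum_card_fiberwise (f := π) (t := univ) (by simp),
    sum_congr rfl fun q _ => hG.card_fiber q, sum_const, smul_eq_mul]

/-- Paths of all lengths exist beyond an ample path that exhausts the fibers over `S`, given also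
an extendable path with one vertex less. -/
theorem exists_isPathList_of_lt (hG : G.IsCliqueFibration π N n) (hn : 3 ≤ n) {S : Finset Q}
    (hS : S.Nonempty) {L L₁ : List V} (hL : G.IsPathList u v L) (hLS : ∀ z ∈ L, π z ∈ S)
    (hLl : L.length = #S * n) (hLA : Ample π N S L)
    (hL₁ : G.IsPathList u v L₁) (hLS₁ : ∀ z ∈ L₁, π z ∈ S)
    (hLl₁ : L₁.length + 1 = #S * n) (hLE : Extendable π N S L₁)
    {l : ℕ} (hl : #S * n < l) (hl' : l ≤ Fintype.card V) :
    ∃ L', G.IsPathList u v L' ∧ L'.length = l := by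
  induction hm : #Sᶜ generalizing S L L₁ with
  | zero =>
    rw [card_eq_zero, compl_eq_empty_iff] at hm
    rw [hG.card_eq] at hl'
    subst hm
    rw [card_univ] at hl
    omega
  | succ m ih =>
    have hS' : S ≠ univ := by rintro rfl; simp at hm
    obtain ⟨D, hD, h⟩ := hG.exists_insert hL hLS hLA.extendable hS hS'
    rcases le_or_gt l (#S * n + n) with hle | hgt
    · rcases (show l = #S * n + 1 ∨ 2 ≤ l - #S * n by omega) with h1 | h1
      -- One vertex more than `L` is two more than `L₁`.
      · obtain ⟨D', -, h'⟩ := hG.exists_insert hL₁ hLS₁ hLE hS hS'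
        obtain ⟨L', hL', -, hl, -⟩ := h' 2 le_rfl (by omega)
        exact ⟨L', hL', by omega⟩
      · obtain ⟨L', hL', -, hl, -⟩ := h (l - #S * n) h1 (by omega)
        exact ⟨L', hL', by omega⟩
    · obtain ⟨L', hL', hLS', hl', hA'⟩ := h n (by omega) le_rfl
      -- The next companion path also comes from `L`, by a shorter detour through the same fiber.
      obtain ⟨L'', hL'', hLS'', hl'', hA''⟩ := h (n - 1) (by omega) (by omega)
      have hc : #(insert D S) * n = #S * n + n := by
        rw [card_insert_of_notMem hD]; ring
      refine ih (insert_nonempty _ _) hL' hLS' (by omega) ((hA' hLA).2 rfl) hL'' hLS'' (by omega)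
        (hA'' hLA).1 (by omega) ?_
      rw [compl_insert, card_erase_of_mem (by simpa using hD), hm, Nat.add_sub_cancel]

/-- Two points of a fiber are joined by paths of all lengths. -/
theorem exists_isPathList_of_eq (hG : G.IsCliqueFibration π N n) (hn : 3 ≤ n) (hne : u ≠ v)
    (huv : π u = π v) {l : ℕ} (hl : 2 ≤ l) (hl' : l ≤ Fintype.card V) :
    ∃ L, G.IsPathList u v L ∧ L.length = l := by
  rcases le_or_gt l n with h | h
  · obtain ⟨L, hL, -, hl⟩ := hG.exists_isPathList_fiber hne huv hl h
    exact ⟨L, hL, hl⟩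
  obtain ⟨L, hL, hLS, hl⟩ := hG.exists_isPathList_fiber hne huv (by omega) le_rfl
  obtain ⟨L₁, hL₁, hLS₁, hl₁⟩ := hG.exists_isPathList_fiber hne huv (j := n - 1)
    (by omega) (by omega)
  refine hG.exists_isPathList_of_lt hn (singleton_nonempty (π u)) hL (by simpa using hLS)
    (by simpa using hl) ?_ hL₁ (by simpa using hLS₁) (by simp; omega) ?_ (by simpa using h) hl'
  · intro A hA
    rw [mem_singleton] at hA
    subst hA
    rw [List.fiberEdges_of_forall L hLS, hl]
    have : #{B | B ∉ ({π u} : Finset Q) ∧ N (π u) B} ≤ #{B | N (π u) B} := by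
      refine card_le_card ?_
      intro C; simp
    have := hG.degree_lt (π u)
    omega
  · intro A hA _
    rw [mem_singleton] at hA
    subst hA
    rw [List.fiberEdges_of_forall L₁ hLS₁, hl₁]
    omega

/-- Two points of distinct fibers are joined by paths of all lengths from `4` on, if these fibers
are joined by an edge that avoids both points. -/
theorem exists_isPathList_of_ne (hG : G.IsCliqueFibration π N n) (hn : 3 ≤ n)
    (huv : π u ≠ π v) {u' v' : V} (hu : u ≠ u') (hv : v' ≠ v) (hu' : π u = π u') (hv' : π v' = π v)
    (hadj : G.Adj u' v') {l : ℕ} (hl : 4 ≤ l) (hl' : l ≤ Fintype.card V) :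
    ∃ L, G.IsPathList u v L ∧ L.length = l := by
  have key : ∀ i j, 2 ≤ i → i ≤ n → 2 ≤ j → j ≤ n → ∃ L, G.IsPathList u v L ∧ L.length = i + j ∧
      (∀ z ∈ L, π z ∈ ({π u, π v} : Finset Q)) ∧
      i - 1 ≤ L.fiberEdges π (π u) ∧ j - 1 ≤ L.fiberEdges π (π v) := by
    intro i j hi hin hj hjn
    obtain ⟨L, hL, hLS, hLl⟩ := hG.exists_isPathList_fiber hu hu' hi hin
    obtain ⟨M, hM, hMS, hMl⟩ := hG.exists_isPathList_fiber hv hv' hj hjn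
    rw [hv'] at hMS
    refine ⟨L ++ M, hL.append hM hadj ?_, by simp [hLl, hMl], ?_, ?_, ?_⟩
    · intro z hz hz'
      exact huv ((hLS z hz).symm.trans (hMS z hz'))
    · intro z hz
      rcases List.mem_append.1 hz with hz | hz
      · simp [hLS z hz]
      · simp [hMS z hz]
    · have := List.fiberEdges_add_le_append (π := π) (q := π u) L M
      rw [List.fiberEdges_of_forall L hLS, hLl] at this
      omega
    · have := List.fiberEdges_add_le_append (π := π) (q := π v) L M
      rw [List.fiberEdges_of_forall M hMS, hMl] at this
      omega
  rcases le_or_gt l (n + n) with h | h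
  · rcases le_or_gt l (n + 2) with h' | h'
    · obtain ⟨L, hL, hl, -⟩ := key (l - 2) 2 (by omega) (by omega) le_rfl (by omega)
      exact ⟨L, hL, by omega⟩
    · obtain ⟨L, hL, hl, -⟩ := key n (l - n) (by omega) (by omega) (by omega) (by omega)
      exact ⟨L, hL, by omega⟩
  obtain ⟨L, hL, hLl, hLS, hLu, hLv⟩ := key n n (by omega) (by omega) (by omega) (by omega)
  obtain ⟨L₁, hL₁, hLl₁, hLS₁, hLu₁, hLv₁⟩ :=
    key n (n - 1) (by omega) (by omega) (by omega) (by omega)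
  have hc : #({π u, π v} : Finset Q) * n = n + n := by rw [card_pair huv]; ring
  refine hG.exists_isPathList_of_lt hn (insert_nonempty _ _) hL hLS (by omega) ?_ hL₁ hLS₁
    (by omega) ?_ (by omega) hl'
  · intro A hA
    have h₁ : #{B | B ∉ ({π u, π v} : Finset Q) ∧ N A B} ≤ #{B | N A B} := by
      refine card_le_card ?_
      intro C; simp
    have h₂ := hG.degree_lt A
    rcases mem_insert.1 hA with rfl | hA
    · omega
    · rw [mem_singleton] at hA
      subst hA
      omega
  · intro A hA _
    rcases mem_insert.1 hA with rfl | hA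
    · omega
    · rw [mem_singleton] at hA
      subst hA
      omega

end IsCliqueFibration

end SimpleGraph
-- Common neighbors by Hall's theorem
namespace arrangementDiffGraph

variable {n k : ℕ}

/-- Any two tuples have a common neighbor. -/
theorem exists_adj_adj (hk : 0 < k) (hkn : k ≤ n) (hn : 4 ≤ n) (a b : Fin k ↪ Fin n) :
    ∃ c, (arrangementDiffGraph n k).Adj a c ∧ (arrangementDiffGraph n k).Adj b c := by
  have hall : ∀ J : Finset (Fin k), #J ≤ #(J.biUnion fun i => ({a i, b i} : Finset (Fin n))ᶜ) := by
    intro J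
    rcases le_or_gt #J 2 with hJ | hJ
    · rcases J.eq_empty_or_nonempty with rfl | ⟨i, hi⟩
      · simp
      · have h₁ : #({a i, b i} : Finset (Fin n))ᶜ ≤ #(J.biUnion fun i => ({a i, b i} : Finset _)ᶜ) :=
          card_le_card (subset_biUnion_of_mem (fun i => ({a i, b i} : Finset (Fin n))ᶜ) hi)
        have h₂ : #({a i, b i} : Finset (Fin n)) ≤ 2 := card_le_two
        rw [card_compl, Fintype.card_fin] at h₁
        omega
    · have : (J.biUnion fun i => ({a i, b i} : Finset (Fin n))ᶜ) = univ := by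
        refine eq_univ_iff_forall.2 fun x => ?_
        by_contra hx
        have hx' : ∀ i ∈ J, x = a i ∨ x = b i := by
          intro i hi
          by_contra h
          exact hx (mem_biUnion.2 ⟨i, hi, by simpa using h⟩)
        obtain ⟨i, hi, j, hj, l, hl, hij, hil, hjl⟩ := two_lt_card.1 hJ
        have h₁ : ∀ i j, i ≠ j → x = a i → x = a j → False :=
          fun i j h hi hj => h (a.injective (hi.symm.trans hj))
        have h₂ : ∀ i j, i ≠ j → x = b i → x = b j → False :=
          fun i j h hi hj => h (b.injective (hi.symm.trans hj))
        rcases hx' i hi with h | h <;> rcases hx' j hj with h' | h' <;>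
          rcases hx' l hl with h'' | h'' <;>
          first
          | exact h₁ _ _ hij h h'
          | exact h₁ _ _ hil h h''
          | exact h₁ _ _ hjl h' h''
          | exact h₂ _ _ hij h h'
          | exact h₂ _ _ hil h h''
          | exact h₂ _ _ hjl h' h''
      rw [this, card_univ, Fintype.card_fin]
      exact (card_le_univ J).trans (by simpa using hkn)
  obtain ⟨f, hf, hfm⟩ := (all_card_le_biUnion_card_iff_exists_injective _).1 hall
  refine ⟨⟨f, hf⟩, (arrangementDiffGraph_adj hk _ _).2 fun i h => ?_,
    (arrangementDiffGraph_adj hk _ _).2 fun i h => ?_⟩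
  · have := hfm i
    rw [show f i = a i from h.symm] at this
    simp at this
  · have := hfm i
    rw [show f i = b i from h.symm] at this
    simp at this

/-! ### Exchanges and translation classes -/

/-- Exchange of the entry of a tuple in position `p` with the value `x`, which is either its entry
in another position or unused. -/
def exchange (p : Fin k) (x : Fin n) (a : Fin k ↪ Fin n) : Fin k ↪ Fin n :=
  a.trans (Equiv.swap (a p) x).toEmbedding

theorem exchange_apply (p : Fin k) (x : Fin n) (a : Fin k ↪ Fin n) (i : Fin k) :
    exchange p x a i = Equiv.swap (a p) x (a i) := rfl

@[simp]
theorem exchange_apply_self (p : Fin k) (x : Fin n) (a : Fin k ↪ Fin n) :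
    exchange p x a p = x := by simp [exchange_apply]

theorem exchange_exchange (p : Fin k) (x : Fin n) (a : Fin k ↪ Fin n) :
    exchange p (a p) (exchange p x a) = a := by
  ext i
  rw [exchange_apply, exchange_apply_self, exchange_apply, Equiv.swap_comm x, Equiv.swap_apply_self]

variable [NeZero n]

/-- Translation of all entries of a tuple by `c`, modulo `n`. -/
def shift (c : Fin n) (a : Fin k ↪ Fin n) : Fin k ↪ Fin n :=
  a.trans (Equiv.addRight c).toEmbedding

@[simp]
theorem shift_apply (c : Fin n) (a : Fin k ↪ Fin n) (i : Fin k) : shift c a i = a i + c := rfl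

theorem exchange_shift (p : Fin k) (c x : Fin n) (a : Fin k ↪ Fin n) :
    exchange p (x + c) (shift c a) = shift c (exchange p x a) := by
  refine DFunLike.ext _ _ fun i => ?_
  simp only [exchange_apply, shift_apply, Equiv.swap_apply_def, add_left_inj]
  split_ifs <;> rfl

/-- The representative with entry `0` in position `p` of the class of `a` under translation. -/
def normalize (p : Fin k) (a : Fin k ↪ Fin n) : {a : Fin k ↪ Fin n // a p = 0} :=
  ⟨shift (-a p) a, by simp⟩

theorem normalize_shift (p : Fin k) (c : Fin n) (a : Fin k ↪ Fin n) :
    normalize p (shift c a) = normalize p a := by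
  refine Subtype.ext (DFunLike.ext _ _ fun i => ?_)
  simp only [normalize, shift_apply]
  abel

theorem normalize_coe (p : Fin k) (q : {a : Fin k ↪ Fin n // a p = 0}) :
    normalize p q.1 = q := by
  refine Subtype.ext (DFunLike.ext _ _ fun i => ?_)
  simp [normalize, q.2]

theorem normalize_eq_iff (p : Fin k) (a b : Fin k ↪ Fin n) :
    normalize p a = normalize p b ↔ ∃ c, b = shift c a := by
  constructor
  · intro h
    refine ⟨b p - a p, DFunLike.ext _ _ fun i => ?_⟩
    have := DFunLike.congr_fun (congrArg Subtype.val h) i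
    simp only [normalize, shift_apply] at this ⊢
    rw [← sub_eq_add_neg, ← sub_eq_add_neg, sub_eq_sub_iff_add_eq_add] at this
    rw [← add_sub_assoc, this, add_sub_cancel_right]
  · rintro ⟨c, rfl⟩
    rw [normalize_shift]

/-- Two translation classes are neighbors if they contain tuples related by an exchange in
position `p`. -/
def Neighbor (p : Fin k) (A B : {a : Fin k ↪ Fin n // a p = 0}) : Prop :=
  ∃ a x, x ≠ a p ∧ normalize p a = A ∧ normalize p (exchange p x a) = B

theorem Neighbor.symm {p : Fin k} {A B : {a : Fin k ↪ Fin n // a p = 0}}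
    (h : Neighbor p A B) : Neighbor p B A := by
  obtain ⟨a, x, hx, hA, hB⟩ := h
  exact ⟨exchange p x a, a p, by simpa using hx.symm, hB, by rw [exchange_exchange, hA]⟩

/-- Exchanges commute with translations, so any tuple of the class can serve as witness. Hence a
class has at most `n - 1` neighbors, one for each `x`. -/
theorem Neighbor.exists_eq {p : Fin k} {A B : {a : Fin k ↪ Fin n // a p = 0}}
    (h : Neighbor p A B) {a : Fin k ↪ Fin n} (ha : normalize p a = A) :
    ∃ x, x ≠ a p ∧ normalize p (exchange p x a) = B := by
  obtain ⟨b, x, hx, hA, hB⟩ := h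
  obtain ⟨c, rfl⟩ := (normalize_eq_iff p b a).1 (hA.trans ha.symm)
  refine ⟨x + c, by simpa using hx, ?_⟩
  rw [exchange_shift, normalize_shift, hB]

theorem adj_shift_shift {a b : Fin k ↪ Fin n} (hk : 0 < k)
    (h : (arrangementDiffGraph n k).Adj a b) (c : Fin n) :
    (arrangementDiffGraph n k).Adj (shift c a) (shift c b) := by
  rw [arrangementDiffGraph_adj hk] at h ⊢
  intro i
  simpa using h i

theorem adj_shift (hk : 0 < k) (a : Fin k ↪ Fin n) {c : Fin n} (hc : c ≠ 0) :
    (arrangementDiffGraph n k).Adj a (shift c a) := by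
  rw [arrangementDiffGraph_adj hk]
  intro i
  simpa using hc

/-- The exchange changes an entry by `0`, `x - a p` or `a p - x`; since `n ≥ 4`, some translation
`d` cancels none of these changes. -/
theorem exists_adj_shift_exchange (hk : 0 < k) (hn : 4 ≤ n) (p : Fin k) (x : Fin n)
    (a : Fin k ↪ Fin n) :
    ∃ d, (arrangementDiffGraph n k).Adj a (shift d (exchange p x a)) := by
  obtain ⟨d, hd⟩ : ∃ d, d ∉ ({0, x - a p, a p - x} : Finset (Fin n)) := by
    by_contra! h
    have h₁ : #({0, x - a p, a p - x} : Finset (Fin n)) ≤ 3 := card_le_three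
    rw [eq_univ_iff_forall.2 h, card_univ, Fintype.card_fin] at h₁
    omega
  simp only [mem_insert, mem_singleton, not_or] at hd
  refine ⟨d, (arrangementDiffGraph_adj hk _ _).2 fun i hi => ?_⟩
  rw [shift_apply, exchange_apply, Equiv.swap_apply_def] at hi
  split_ifs at hi with h₁ h₂
  · rw [h₁] at hi
    exact hd.2.2 (by rw [hi, add_sub_cancel_left])
  · rw [h₂] at hi
    exact hd.2.1 (by rw [hi, add_sub_cancel_left])
  · exact hd.1 (by simpa using hi)

/-- A family of translation classes that is closed under neighbors contains all of them. -/
theorem mem_of_forall_neighbor (p : Fin k) {S : Finset {a : Fin k ↪ Fin n // a p = 0}}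
    (hS : S.Nonempty) (h : ∀ A ∈ S, ∀ B, Neighbor p A B → B ∈ S)
    (B : {a : Fin k ↪ Fin n // a p = 0}) : B ∈ S := by
  have hex : ∀ a x, normalize p a ∈ S → normalize p (exchange p x a) ∈ S := by
    intro a x ha
    by_cases hx : x = a p
    · have : exchange p x a = a := by ext i; simp [exchange_apply, hx]
      rwa [this]
    · exact h _ ha _ ⟨a, x, hx, rfl, rfl⟩
  have hsw : ∀ (x y : Fin n) (a : Fin k ↪ Fin n), normalize p a ∈ S →
      normalize p (Equiv.swap x y • a) ∈ S := by
    intro x y a ha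
    by_cases hx : a p = x
    · subst hx
      exact hex a y ha
    by_cases hy : a p = y
    · subst hy
      rw [Equiv.swap_comm]
      exact hex a x ha
    -- With `z = a p`, the transposition `(x y)` is the product `(y z)(x y)(z x)`, and each factor
    -- in turn is an exchange in position `p`.
    · have := hex _ (a p) (hex _ y (hex a x ha))
      convert this using 2
      refine DFunLike.ext _ _ fun i => ?_
      rw [exchange_apply, exchange_apply_self, exchange_apply, exchange_apply_self, exchange_apply,
        Function.Embedding.smul_apply, Equiv.Perm.smul_def]
      simp only [Equiv.swap_apply_def]
      split_ifs <;> simp_all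
  have hperm : ∀ (σ : Equiv.Perm (Fin n)) (a : Fin k ↪ Fin n), normalize p a ∈ S →
      normalize p (σ • a) ∈ S := by
    intro σ a ha
    induction σ using Equiv.Perm.swap_induction_on with
    | one => rwa [one_smul]
    | swap_mul σ x y _ ih =>
      rw [mul_smul]
      exact hsw x y _ ih
  obtain ⟨A, hA⟩ := hS
  have := Equiv.Perm.isMultiplyPretransitive (Fin n) k
  obtain ⟨σ, hσ⟩ := this.exists_smul_eq A.1 B.1
  have := hperm σ A.1 (by rwa [normalize_coe])
  rwa [hσ, normalize_coe] at this

open Classical in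
theorem isCliqueFibration (hk : 0 < k) (hn : 4 ≤ n) (p : Fin k) :
    (arrangementDiffGraph n k).IsCliqueFibration (normalize p) (Neighbor p) n where
  adj_of_ne a b hab hne := by
    obtain ⟨c, rfl⟩ := (normalize_eq_iff p a b).1 hab
    refine adj_shift hk a ?_
    rintro rfl
    exact hne (by ext i; simp)
  card_fiber q := by
    have hinj : Function.Injective fun c => shift c q.1 := by
      intro c d h
      simpa using DFunLike.congr_fun h p
    have : ({a | normalize p a = q} : Finset (Fin k ↪ Fin n)) =
        univ.image fun c => shift c q.1 := by
      ext a
      rw [mem_filter_univ, mem_image_univ_iff_mem_range, Set.mem_range]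
      conv_lhs => rw [← normalize_coe p q, eq_comm, normalize_eq_iff]
      simp only [eq_comm]
    rw [this, card_image_of_injective _ hinj, card_univ, Fintype.card_fin]
  symm A B h := h.symm
  degree_lt A := by
    have : ({B | Neighbor p A B} : Finset _) ⊆
        (univ.erase (A.1 p)).image fun x => normalize p (exchange p x A.1) := by
      intro B hB
      rw [mem_filter_univ] at hB
      obtain ⟨x, hx, h⟩ := hB.exists_eq (normalize_coe p A)
      exact mem_image.2 ⟨x, by simpa using hx, h⟩
    refine (card_le_card this).trans_lt (card_image_le.trans_lt ?_)
    rw [card_erase_of_mem (mem_univ _), card_univ, Fintype.card_fin]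
    omega
  exists_boundary S hS hS' := by
    by_contra! h
    refine hS' (eq_univ_iff_forall.2 (mem_of_forall_neighbor p hS fun A hA B hAB => ?_))
    by_contra hB
    exact h A hA B hB hAB
  exists_adj A B hAB a b hne ha hb := by
    obtain ⟨c, rfl⟩ := (normalize_eq_iff p a b).1 (ha.trans hb.symm)
    obtain ⟨x, -, hB⟩ := hAB.exists_eq ha
    obtain ⟨d, hd⟩ := exists_adj_shift_exchange hk hn p x a
    -- The second edge is the translate of the first by `c`.
    refine ⟨_, shift c (shift d (exchange p x a)), fun h => hne ?_, ?_, ?_, hd,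
      adj_shift_shift hk hd c⟩
    · have : c = 0 := by simpa using DFunLike.congr_fun h p
      subst this
      ext i; simp
    · rw [normalize_shift, hB]
    · rw [normalize_shift, normalize_shift, hB]

end arrangementDiffGraph

theorem theorem1p4 (n k : ℕ) (hk : 4 ≤ k) (hn : k ≤ n) :
    (arrangementDiffGraph n k).IsEdgePancyclic := by
  classical
  have hn4 : 4 ≤ n := hk.trans hn
  have hk0 : 0 < k := by omega
  have : NeZero n := ⟨by omega⟩
  have hG := arrangementDiffGraph.isCliqueFibration hk0 hn4 ⟨0, hk0⟩
  refine ⟨?_, fun e he l hl hl' => ?_⟩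
  · have h₁ := hG.card_fiber (arrangementDiffGraph.normalize _ (Fin.castLEEmb hn))
    have h₂ := h₁.symm.le.trans (card_le_univ _)
    omega
  induction e with
  | h u v =>
  rw [SimpleGraph.mem_edgeSet] at he
  suffices ∃ L, (arrangementDiffGraph n k).IsPathList u v L ∧ L.length = l by
    obtain ⟨L, hL, rfl⟩ := this
    exact hL.exists_isCycle he hl
  by_cases huv : arrangementDiffGraph.normalize ⟨0, hk0⟩ u =
      arrangementDiffGraph.normalize ⟨0, hk0⟩ v
  · exact hG.exists_isPathList_of_eq (by omega) he.ne huv (by omega) hl'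
  rcases hl.eq_or_lt with rfl | hl
  · obtain ⟨w, huw, hvw⟩ := arrangementDiffGraph.exists_adj_adj hk0 hn hn4 u v
    refine ⟨[u, w, v], ⟨by simp [huw, hvw.symm], ?_, rfl, rfl⟩, rfl⟩
    simp [huw.ne, he.ne, hvw.ne.symm]
  · have h1 : (1 : Fin n) ≠ 0 := by
      rw [Ne, Fin.ext_iff, Fin.val_one', Fin.val_zero, Nat.mod_eq_of_lt (by omega)]
      omega
    -- The edge `u v` translated by `1` joins the two classes and avoids both `u` and `v`.
    exact hG.exists_isPathList_of_ne (by omega) huv (arrangementDiffGraph.adj_shift hk0 u h1).ne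
      (arrangementDiffGraph.adj_shift hk0 v h1).ne.symm
      (arrangementDiffGraph.normalize_shift _ _ _).symm
      (arrangementDiffGraph.normalize_shift _ _ _)
      (arrangementDiffGraph.adj_shift_shift hk0 he 1) (by omega) hl'
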